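/- A field is called real if $-1$ is not a sum of squares in it. For a field $k$ let $p(k)$ denote its Pythagoras number, i.e. the smallest natural number $p$ such that every sum of squares in $k$ is a sum of $p$ squares in $k$, with $p(k)=\infty$ if no such $p$ exists. "A sum of $m$ squares" allows zero summands. Theorem 1.2. Let $K/k$ be an extension of real fields of finite degree $d=[K:k]<\infty$, and assume that every ordering of $k$ extends to $d$ different orderings of $K$. Then there exist sums of squares $c_1,\dots,c_d$ in $k$ with $c_1=1$ and with the following property: for every commutative $k$-algebra $A$, every integer $m\ge 1$ and every $f\in A$ such that $f\otimes 1$ is a sum of $m$ squares in $A_K=A\otimes_k K$, there exist $f_1,\dots,f_d\in A$, each of them a sum of $m$ squares in $A$, such that $$f=\sum_{i=1}^d c_i f_i .$$ In particular, $f$ is a sum of squares in $A$, and if $p(k)<\infty$, then $f$ is a sum of $d\,m\cdot p(k)$ squares in $A$. -/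

import Mathlib

open scoped TensorProduct

/-- `x` is a sum of `n` squares in the ring `R` (zero summands are allowed). -/
def IsSumOfNSquares {R : Type*} [CommRing R] (n : ℕ) (x : R) : Prop :=
  ∃ g : Fin n → R, x = ∑ j, g j ^ 2

/-- The Pythagoras number of `R`: the smallest `p` such that every sum of squares in `R` is a sum
of `p` squares in `R`, and `⊤` if there is no such natural number. -/
noncomputable def pythagorasNumber (R : Type*) [CommRing R] : ℕ∞ :=
  sInf {p : ℕ∞ | ∃ n : ℕ, p = n ∧ ∀ x : R, IsSumSq x → IsSumOfNSquares n x}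

/-- The orderings `Q` of the field `K` which extend the ordering `P` of the subfield `k`,
i.e. whose restriction to `k` is `P`. (Orderings are given by their sets of nonnegative
elements.) -/
def orderingExtensions {k : Type*} (K : Type*) [Field k] [Field K] [Algebra k K]
    (P : RingPreordering k) : Set (RingPreordering K) :=
  {Q | Q.IsOrdering ∧ ∀ x : k, algebraMap k K x ∈ Q ↔ x ∈ P}

/-! Let `s` be the trace of `K/k` divided by `d`, so that `s 1 = 1`. Diagonalise the form `s (x *
y)` in a basis that starts with `1`. If `f ⊗ 1 = ∑ z_j ^ 2`, expand each `z_j` in this basis and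
apply `id ⊗ s`: the cross terms vanish, and `f` becomes a combination of sums of `m` squares of `A`
with the weights `c_i = s (e_i ^ 2)`. These weights do not depend on `A`, `m` or `f`.

It remains to see that each `c_i` is a sum of squares. By Artin, it is enough that it lies in every
ordering `P` of `k`. Let `M` be a real closure of `(k, P)`. Every extension of `P` to `K` is induced
by a `k`-embedding of `K` into `M`, and different extensions need different embeddings. Hence `d`
extensions account for all `d` embeddings into an algebraic closure, and the trace of `x ^ 2` is a
sum of squares in `M`.

A real closure is taken to be an algebraic ordered extension with the intermediate value property
for polynomials. Its existence (`exists_polynomialIVT`) comes from Zorn's lemma, and its uniqueness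
(`PolynomialIVT.exists_algHom`) from comparing signs along cuts. -/

/-! ### Preorderings of fields and Artin's theorem -/

namespace RingPreordering

variable {F : Type*} [Field F]

theorem isOrdering_of_mem_or_neg_mem {P : RingPreordering F} (h : ∀ x, x ∈ P ∨ -x ∈ P) :
    P.IsOrdering :=
  have : HasMemOrNegMem P := ⟨h⟩
  { mem_or_neg_mem := h, toIsPrime := inferInstance }

theorem IsOrdering.mem_or_neg_mem' {P : RingPreordering F} (hP : P.IsOrdering) (x : F) :
    x ∈ P ∨ -x ∈ P :=
  hP.toHasMemOrNegMem.mem_or_neg_mem x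

/-- The preordering generated by a preordering and the negative of an element outside of it. -/
def adjoinNeg (P : RingPreordering F) {a : F} (ha : a ∉ P) : RingPreordering F :=
  mk' {x | ∃ s ∈ P, ∃ t ∈ P, x = s - a * t}
    (by
      rintro _ _ ⟨s, hs, t, ht, rfl⟩ ⟨s', hs', t', ht', rfl⟩
      exact ⟨s + s', add_mem hs hs', t + t', add_mem ht ht', by ring⟩)
    (by
      rintro _ _ ⟨s, hs, t, ht, rfl⟩ ⟨s', hs', t', ht', rfl⟩
      exact ⟨s * s' + a * a * (t * t'),
        add_mem (mul_mem hs hs') (mul_mem (P.mul_self_mem a) (mul_mem ht ht')),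
        s * t' + t * s', add_mem (mul_mem hs ht') (mul_mem ht hs'), by ring⟩)
    (fun x => ⟨x * x, P.mul_self_mem x, 0, zero_mem P, by ring⟩)
    (by
      rintro ⟨s, hs, t, ht, h⟩
      rcases eq_or_ne t 0 with rfl | ht0
      · exact P.neg_one_notMem (by rw [h]; simpa using hs)
      · refine ha ?_
        -- The identity `-1 = s - a * t` can be solved for `a`, which would put `a` in `P`.
        have : a = (1 + s) * t⁻¹ := by
          field_simp
          linear_combination h
        rw [this]
        exact mul_mem (add_mem (one_mem P) hs) (inv_mem ht))

theorem le_adjoinNeg (P : RingPreordering F) {a : F} (ha : a ∉ P) : P ≤ P.adjoinNeg ha :=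
  fun x hx => ⟨x, hx, 0, zero_mem P, by ring⟩

theorem neg_mem_adjoinNeg (P : RingPreordering F) {a : F} (ha : a ∉ P) : -a ∈ P.adjoinNeg ha :=
  ⟨0, zero_mem P, 1, one_mem P, by ring⟩

/-- Every preordering of a field is contained in an ordering. -/
theorem exists_le_isOrdering (T : RingPreordering F) :
    ∃ Q : RingPreordering F, T ≤ Q ∧ Q.IsOrdering := by
  obtain ⟨Q, hTQ, hQ⟩ := zorn_le_nonempty_Ici₀ T (fun c _ hc y hy => by
    have dir : ∀ {x z : F}, (∃ P ∈ c, x ∈ P) → (∃ P ∈ c, z ∈ P) →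
        ∃ P ∈ c, x ∈ P ∧ z ∈ P := by
      rintro x z ⟨P, hP, hx⟩ ⟨P', hP', hz⟩
      rcases hc.total hP hP' with h | h
      · exact ⟨P', hP', h hx, hz⟩
      · exact ⟨P, hP, hx, h hz⟩
    refine ⟨mk' {x | ∃ P ∈ c, x ∈ P} ?_ ?_ ?_ ?_, fun z hz x hx => ⟨z, hz, hx⟩⟩
    · intro x z hx hz
      obtain ⟨P, hP, h1, h2⟩ := dir hx hz
      exact ⟨P, hP, add_mem h1 h2⟩
    · intro x z hx hz
      obtain ⟨P, hP, h1, h2⟩ := dir hx hz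
      exact ⟨P, hP, mul_mem h1 h2⟩
    · exact fun x => ⟨y, hy, y.mul_self_mem x⟩
    · rintro ⟨P, -, h⟩
      exact P.neg_one_notMem h) T le_rfl
  refine ⟨Q, hTQ, isOrdering_of_mem_or_neg_mem fun x => ?_⟩
  by_cases hx : x ∈ Q
  · exact .inl hx
  · exact .inr (hQ (Q.le_adjoinNeg hx) (Q.neg_mem_adjoinNeg hx))

/-- An element of a real field which lies in all orderings is a sum of squares. -/
theorem isSumSq_of_forall_mem [IsSemireal F] {x : F}
    (hx : ∀ P : RingPreordering F, P.IsOrdering → x ∈ P) : IsSumSq x := by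
  by_contra hn
  let T : RingPreordering F := mk' {y | IsSumSq y} (fun h h' => h.add h') (fun h h' => h.mul h')
    (fun y => IsSumSq.mul_self y) (IsSemireal.not_isSumSq_neg_one F)
  obtain ⟨Q, hTQ, hQ⟩ := (T.adjoinNeg (a := x) hn).exists_le_isOrdering
  have h0 := RingPreordering.eq_zero_of_mem_of_neg_mem (hx Q hQ) (hTQ (T.neg_mem_adjoinNeg hn))
  exact hn (h0 ▸ IsSumSq.zero)

/-- An ordering of a field is the set of nonnegative elements of a linear order. -/
theorem IsOrdering.exists_linearOrder {P : RingPreordering F} (hP : P.IsOrdering) :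
    ∃ (_ : LinearOrder F) (_ : IsStrictOrderedRing F), ∀ x : F, 0 ≤ x ↔ x ∈ P := by
  classical
  let C : RingCone F :=
    { P.toSubsemiring with
      eq_zero_of_mem_of_neg_mem' := fun h h' =>
        RingPreordering.eq_zero_of_mem_of_neg_mem (P := P) h h' }
  have : HasMemOrNegMem C := ⟨hP.mem_or_neg_mem'⟩
  let _ : LinearOrder F := LinearOrder.mkOfAddGroupCone C
  have : IsOrderedRing F := IsOrderedRing.mkOfCone C
  refine ⟨inferInstance, IsOrderedRing.toIsStrictOrderedRing F, fun x => ?_⟩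
  change x - 0 ∈ C ↔ x ∈ P
  rw [sub_zero]
  rfl

end RingPreordering

/-! ### Sign changes and extension of orders to a root -/

section Polynomial

open Polynomial

/-- Polynomials over the ordered field `M` satisfy the intermediate value property. -/
def PolynomialIVT (M : Type*) [Field M] [LinearOrder M] : Prop :=
  ∀ (f : M[X]) (a b : M), a < b → f.eval a * f.eval b < 0 → ∃ c, a < c ∧ c < b ∧ f.eval c = 0

namespace Polynomial

variable {L : Type*} [Field L] [LinearOrder L] [IsStrictOrderedRing L]

theorem exists_irreducible_dvd_of_eval_mul_eval_neg {a b : L} (f : L[X])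
    (hf : f.eval a * f.eval b < 0) :
    ∃ g : L[X], Irreducible g ∧ g ∣ f ∧ g.eval a * g.eval b < 0 := by
  induction f using WfDvdMonoid.induction_on_irreducible with
  | zero => simp at hf
  | unit u hu =>
    obtain ⟨c, -, rfl⟩ := Polynomial.isUnit_iff.mp hu
    simp only [eval_C] at hf
    exact absurd hf (mul_self_nonneg c).not_gt
  | mul h i hh0 hi ih =>
    by_cases hineg : i.eval a * i.eval b < 0
    · exact ⟨i, hi, dvd_mul_right _ _, hineg⟩
    · obtain ⟨g, hg, hgd, hneg⟩ := ih (by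
        by_contra hc
        refine absurd hf (not_lt.mpr ?_)
        rw [eval_mul, eval_mul]
        have := mul_nonneg (not_lt.mp hineg) (not_lt.mp hc)
        linarith)
      exact ⟨g, hg, hgd.mul_left _, hneg⟩

/-- The sums of squares with nonnegative weights in the polynomial ring. -/
noncomputable def weightedSumSq (L : Type*) [Field L] [LinearOrder L] : AddSubmonoid L[X] :=
  AddSubmonoid.closure {p | ∃ (c : L) (q : L[X]), 0 ≤ c ∧ p = C c * q ^ 2}

theorem eval_nonneg_of_mem_weightedSumSq {s : L[X]} (hs : s ∈ weightedSumSq L) (a : L) :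
    0 ≤ s.eval a := by
  induction hs using AddSubmonoid.closure_induction with
  | mem x h =>
    obtain ⟨c, q, hc, rfl⟩ := h
    simp only [eval_mul, eval_C, eval_pow]
    positivity
  | zero => simp
  | add x y _ _ hx hy => rw [eval_add]; exact add_nonneg hx hy

theorem mul_mem_weightedSumSq {s t : L[X]} (hs : s ∈ weightedSumSq L)
    (ht : t ∈ weightedSumSq L) : s * t ∈ weightedSumSq L := by
  induction hs using AddSubmonoid.closure_induction with
  | mem x h =>
    obtain ⟨c, q, hc, rfl⟩ := h
    induction ht using AddSubmonoid.closure_induction with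
    | mem x h =>
      obtain ⟨c', q', hc', rfl⟩ := h
      exact AddSubmonoid.subset_closure ⟨c * c', q * q', mul_nonneg hc hc', by
        rw [C_mul]; ring⟩
    | zero => simp
    | add x y _ _ hx hy => rw [mul_add]; exact add_mem hx hy
  | zero => simp
  | add x y _ _ hx hy => rw [add_mul]; exact add_mem hx hy

-- Each `q` is replaced by its remainder modulo `g`, with the weights kept. The degree bound drives
-- the descent in `not_dvd_one_add_of_eval_mul_eval_neg`.
omit [IsStrictOrderedRing L] in
theorem exists_natDegree_le_of_mem_weightedSumSq {g : L[X]} (hg : 0 < g.natDegree) {s : L[X]}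
    (hs : s ∈ weightedSumSq L) :
    ∃ t ∈ weightedSumSq L, g ∣ s - t ∧ t.natDegree ≤ 2 * (g.natDegree - 1) := by
  induction hs using AddSubmonoid.closure_induction with
  | mem x h =>
    obtain ⟨c, q, hc, rfl⟩ := h
    refine ⟨C c * (q % g) ^ 2, AddSubmonoid.subset_closure ⟨c, _, hc, rfl⟩, ?_, ?_⟩
    · have h1 : g ∣ q - q % g := ⟨q / g, by rw [sub_eq_iff_eq_add, EuclideanDomain.div_add_mod]⟩
      rw [show C c * q ^ 2 - C c * (q % g) ^ 2 = C c * (q + q % g) * (q - q % g) by ring]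
      exact h1.mul_left _
    · refine (natDegree_C_mul_le _ _).trans (natDegree_pow_le.trans ?_)
      have := natDegree_mod_lt q hg.ne'
      omega
  | zero => exact ⟨0, zero_mem _, by simp, by simp⟩
  | add x y _ _ hx hy =>
    obtain ⟨t, ht, h1, h2⟩ := hx
    obtain ⟨t', ht', h1', h2'⟩ := hy
    refine ⟨t + t', add_mem ht ht', ?_, (natDegree_add_le _ _).trans (max_le h2 h2')⟩
    rw [add_sub_add_comm]
    exact dvd_add h1 h1'

/-- If an irreducible polynomial `g` changes sign, then `-1` is not a weighted sum of squares
modulo `g`. -/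
theorem not_dvd_one_add_of_eval_mul_eval_neg {a b : L} {g : L[X]} (hg : Irreducible g)
    (hneg : g.eval a * g.eval b < 0) {s : L[X]} (hs : s ∈ weightedSumSq L) : ¬ g ∣ 1 + s := by
  -- Descent on the degree: write `1 + t = g * h` with `t` reduced modulo `g`, so that `h` has
  -- smaller degree than `g`. As `g * h` is positive everywhere, `h` changes sign along with `g`,
  -- and so does some irreducible factor of `h`, which again divides `1 + t`.
  induction hn : g.natDegree using Nat.strong_induction_on generalizing g s with
  | _ n ih =>
    intro hd
    have hpos : 0 < g.natDegree := hg.natDegree_pos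
    obtain ⟨t, ht, htd, htn⟩ := exists_natDegree_le_of_mem_weightedSumSq hpos hs
    obtain ⟨h, hh⟩ : g ∣ 1 + t := by
      have := dvd_sub hd htd
      rwa [show 1 + s - (s - t) = 1 + t by ring] at this
    have hev : ∀ z : L, 0 < g.eval z * h.eval z := fun z => by
      rw [← eval_mul, ← hh, eval_add, eval_one]
      linarith [eval_nonneg_of_mem_weightedSumSq ht z]
    have hh0 : h ≠ 0 := by
      rintro rfl
      simpa using hev a
    have hdeg : h.natDegree < g.natDegree := by
      have h1 := natDegree_mul hg.ne_zero hh0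
      rw [← hh] at h1
      have h2 : (1 + t).natDegree ≤ 2 * (g.natDegree - 1) :=
        (natDegree_add_le _ _).trans (max_le (by simp) htn)
      omega
    have hhneg : h.eval a * h.eval b < 0 := by
      by_contra hc
      have h1 := mul_pos (hev a) (hev b)
      have h2 := mul_nonpos_of_nonpos_of_nonneg hneg.le (not_lt.mp hc)
      nlinarith
    obtain ⟨g₁, hg₁, hg₁d, hg₁neg⟩ := exists_irreducible_dvd_of_eval_mul_eval_neg h hhneg
    have hle := natDegree_le_of_dvd hg₁d hh0
    exact ih g₁.natDegree (by omega) hg₁ hg₁neg ht rfl (hh ▸ hg₁d.mul_left g)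

end Polynomial

/-- The order of a field extends to the extension generated by a root of an irreducible
polynomial which changes sign. -/
theorem AdjoinRoot.exists_isOrdering {L : Type*} [Field L] [LinearOrder L] [IsStrictOrderedRing L]
    {a b : L} {g : L[X]} [hg : Fact (Irreducible g)] (hneg : g.eval a * g.eval b < 0) :
    ∃ Q : RingPreordering (AdjoinRoot g), Q.IsOrdering ∧ ∀ c : L, 0 ≤ c → AdjoinRoot.of g c ∈ Q := by
  have hmem : ∀ s ∈ weightedSumSq L, AdjoinRoot.mk g s ≠ -1 := fun s hs h => by
    refine not_dvd_one_add_of_eval_mul_eval_neg hg.out hneg hs (AdjoinRoot.mk_eq_zero.mp ?_)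
    rw [map_add, h, map_one, add_neg_cancel]
  let T : RingPreordering (AdjoinRoot g) := RingPreordering.mk'
    (AdjoinRoot.mk g '' (weightedSumSq L))
    (by
      rintro _ _ ⟨s, hs, rfl⟩ ⟨t, ht, rfl⟩
      exact ⟨s + t, add_mem hs ht, map_add _ _ _⟩)
    (by
      rintro _ _ ⟨s, hs, rfl⟩ ⟨t, ht, rfl⟩
      exact ⟨s * t, mul_mem_weightedSumSq hs ht, map_mul _ _ _⟩)
    (by
      intro x
      obtain ⟨q, rfl⟩ := AdjoinRoot.mk_surjective x
      refine ⟨q ^ 2, AddSubmonoid.subset_closure ⟨1, q, zero_le_one, by simp⟩, ?_⟩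
      rw [map_pow, sq])
    (by
      rintro ⟨s, hs, h⟩
      exact hmem s hs h)
  obtain ⟨Q, hTQ, hQ⟩ := T.exists_le_isOrdering
  refine ⟨Q, hQ, fun c hc => hTQ ⟨C c, AddSubmonoid.subset_closure ⟨c, 1, hc, by simp⟩, rfl⟩⟩

/-! ### Existence of real closures -/

/-- `P` is the set of nonnegative elements of an order on a subfield of `Ω`. -/
structure IsFieldCone {Ω : Type*} [Field Ω] (P : Set Ω) : Prop where
  one_mem : 1 ∈ P
  add_mem : ∀ {x y}, x ∈ P → y ∈ P → x + y ∈ P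
  mul_mem : ∀ {x y}, x ∈ P → y ∈ P → x * y ∈ P
  inv_mem : ∀ {x}, x ∈ P → x⁻¹ ∈ P
  neg_one_notMem : -1 ∉ P
  sub_mem : ∀ {x y}, x ∈ P → y ∈ P → x - y ∈ P ∨ y - x ∈ P

namespace IsFieldCone

variable {Ω : Type*} [Field Ω] {P : Set Ω}

theorem zero_mem (hP : IsFieldCone P) : 0 ∈ P := by
  simpa using hP.sub_mem hP.one_mem hP.one_mem

theorem eq_zero_of_neg_mem (hP : IsFieldCone P) {x : Ω} (hx : x ∈ P) (hx' : -x ∈ P) : x = 0 := by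
  by_contra h0
  refine hP.neg_one_notMem ?_
  have := hP.mul_mem hx' (hP.inv_mem hx)
  rwa [neg_mul, mul_inv_cancel₀ h0] at this

theorem of_isOrdering {E : Type*} [Field E] {Q : RingPreordering E} (hQ : Q.IsOrdering)
    (φ : E →+* Ω) : IsFieldCone (φ '' Q) where
  one_mem := ⟨1, OneMemClass.one_mem Q, map_one φ⟩
  add_mem := by
    rintro _ _ ⟨x, hx, rfl⟩ ⟨y, hy, rfl⟩
    exact ⟨x + y, AddMemClass.add_mem hx hy, map_add φ x y⟩
  mul_mem := by
    rintro _ _ ⟨x, hx, rfl⟩ ⟨y, hy, rfl⟩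
    exact ⟨x * y, MulMemClass.mul_mem hx hy, map_mul φ x y⟩
  inv_mem := by
    rintro _ ⟨x, hx, rfl⟩
    exact ⟨x⁻¹, RingPreordering.inv_mem hx, map_inv₀ φ x⟩
  neg_one_notMem := by
    rintro ⟨x, hx, h⟩
    have : x = -1 := φ.injective (by rw [h, map_neg, map_one])
    exact Q.neg_one_notMem (this ▸ hx)
  sub_mem := by
    rintro _ _ ⟨x, -, rfl⟩ ⟨y, -, rfl⟩
    rcases hQ.mem_or_neg_mem' (x - y) with h | h
    · exact .inl ⟨x - y, h, map_sub φ x y⟩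
    · exact .inr ⟨-(x - y), h, by rw [neg_sub, map_sub]⟩

theorem sUnion {c : Set (Set Ω)} (hc : ∀ P ∈ c, IsFieldCone P) (hch : IsChain (· ⊆ ·) c)
    (hne : c.Nonempty) : IsFieldCone (⋃₀ c) := by
  have dir : ∀ {x y : Ω}, x ∈ ⋃₀ c → y ∈ ⋃₀ c → ∃ P ∈ c, x ∈ P ∧ y ∈ P := by
    rintro x y ⟨P, hP, hx⟩ ⟨P', hP', hy⟩
    rcases hch.total hP hP' with h | h
    · exact ⟨P', hP', h hx, hy⟩
    · exact ⟨P, hP, hx, h hy⟩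
  constructor
  · obtain ⟨P, hP⟩ := hne
    exact ⟨P, hP, (hc P hP).one_mem⟩
  · intro x y hx hy
    obtain ⟨P, hP, h, h'⟩ := dir hx hy
    exact ⟨P, hP, (hc P hP).add_mem h h'⟩
  · intro x y hx hy
    obtain ⟨P, hP, h, h'⟩ := dir hx hy
    exact ⟨P, hP, (hc P hP).mul_mem h h'⟩
  · rintro x ⟨P, hP, hx⟩
    exact ⟨P, hP, (hc P hP).inv_mem hx⟩
  · rintro ⟨P, hP, hx⟩
    exact (hc P hP).neg_one_notMem hx
  · intro x y hx hy
    obtain ⟨P, hP, h, h'⟩ := dir hx hy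
    exact ((hc P hP).sub_mem h h').imp (fun h => ⟨P, hP, h⟩) (fun h => ⟨P, hP, h⟩)

/-- The subfield of which `P` is the positive cone. -/
def subfield (hP : IsFieldCone P) : Subfield Ω where
  carrier := {x | x ∈ P ∨ -x ∈ P}
  zero_mem' := .inl hP.zero_mem
  one_mem' := .inl hP.one_mem
  neg_mem' := by
    rintro x (h | h)
    · exact .inr (by rwa [neg_neg])
    · exact .inl h
  add_mem' := by
    rintro x y (hx | hx) (hy | hy)
    · exact .inl (hP.add_mem hx hy)
    · simpa [sub_eq_add_neg, add_comm] using hP.sub_mem hx hy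
    · simpa [sub_eq_add_neg, add_comm] using hP.sub_mem hy hx
    · exact .inr (by simpa [add_comm] using hP.add_mem hx hy)
  mul_mem' := by
    rintro x y (hx | hx) (hy | hy)
    · exact .inl (hP.mul_mem hx hy)
    · exact .inr (by simpa using hP.mul_mem hx hy)
    · exact .inr (by simpa using hP.mul_mem hx hy)
    · exact .inl (by simpa using hP.mul_mem hx hy)
  inv_mem' := by
    rintro x (h | h)
    · exact .inl (hP.inv_mem h)
    · exact .inr (by simpa using hP.inv_mem h)

theorem exists_linearOrder (hP : IsFieldCone P) :
    ∃ (_ : LinearOrder hP.subfield) (_ : IsStrictOrderedRing hP.subfield),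
      ∀ x : hP.subfield, 0 ≤ x ↔ (x : Ω) ∈ P := by
  let Q : RingPreordering hP.subfield := RingPreordering.mk' {x | (x : Ω) ∈ P}
    (fun hx hy => hP.add_mem hx hy) (fun hx hy => hP.mul_mem hx hy)
    (by
      rintro ⟨x, hx | hx⟩
      · exact hP.mul_mem hx hx
      · simpa using hP.mul_mem hx hx) hP.neg_one_notMem
  exact RingPreordering.IsOrdering.exists_linearOrder
    (RingPreordering.isOrdering_of_mem_or_neg_mem (P := Q) fun x => x.2)

/-- An irreducible factor `g` of `f` still changes sign, so the order extends to `AdjoinRoot g`,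
which embeds into `Ω`. By maximality the image cone is `P` itself, so the subfield already contains
a root of `g`. Thus `g` is linear, and its sign change places the root between `a` and `b`. -/
theorem polynomialIVT_of_maximal [IsAlgClosed Ω] (hP : Maximal IsFieldCone P)
    [LinearOrder hP.prop.subfield] [IsStrictOrderedRing hP.prop.subfield]
    (h : ∀ x : hP.prop.subfield, 0 ≤ x ↔ (x : Ω) ∈ P) : PolynomialIVT hP.prop.subfield := by
  intro f a b hab hf
  obtain ⟨g, hg, hgf, hneg⟩ := exists_irreducible_dvd_of_eval_mul_eval_neg f hf
  have : Fact (Irreducible g) := ⟨hg⟩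
  obtain ⟨Q, hQ, hcQ⟩ := AdjoinRoot.exists_isOrdering hneg
  obtain ⟨θ, hθ⟩ := IsAlgClosed.exists_eval₂_eq_zero hP.prop.subfield.subtype g
    (degree_pos_of_irreducible hg).ne'
  let φ : AdjoinRoot g →+* Ω := AdjoinRoot.lift hP.prop.subfield.subtype θ hθ
  have hcone := IsFieldCone.of_isOrdering hQ φ
  have hle : P ⊆ φ '' Q := fun x hx =>
    ⟨AdjoinRoot.of g ⟨x, .inl hx⟩, hcQ _ ((h _).mpr hx), by simp [φ]⟩
  have hge : φ '' Q ⊆ P := hP.le_of_ge hcone hle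
  have hroot : θ ∈ hP.prop.subfield := by
    have hφ : φ (AdjoinRoot.root g) = θ := by simp [φ]
    rcases hQ.mem_or_neg_mem' (AdjoinRoot.root g) with hr | hr
    · exact .inl (hge ⟨_, hr, hφ⟩)
    · exact .inr (hge ⟨_, hr, by rw [map_neg, hφ]⟩)
  have hgr : g.IsRoot ⟨θ, hroot⟩ := by
    refine Subtype.ext ?_
    have : hP.prop.subfield.subtype (g.eval ⟨θ, hroot⟩) = 0 := by
      rw [← eval₂_hom]
      exact hθ
    exact this
  generalize (⟨θ, hroot⟩ : hP.prop.subfield) = r at hgr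
  obtain ⟨u, hu⟩ := (hg.associated_of_dvd (irreducible_X_sub_C r)
    (by
      have h1 := (irreducible_X_sub_C r).associated_of_dvd hg (dvd_iff_isRoot.mpr hgr)
      exact h1.symm.dvd)).symm
  obtain ⟨c, -, hc⟩ := Polynomial.isUnit_iff.mp u.isUnit
  rw [← hu, ← hc] at hneg
  simp only [eval_mul, eval_sub, eval_X, eval_C] at hneg
  have hsign : (a - r) * (b - r) < 0 := by
    by_contra hn
    have := mul_nonneg (mul_self_nonneg c) (not_lt.mp hn)
    nlinarith
  refine ⟨r, ?_, ?_, ?_⟩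
  · by_contra hn
    have := mul_nonneg (sub_nonneg.mpr (not_lt.mp hn)) (sub_nonneg.mpr ((not_lt.mp hn).trans hab.le))
    exact absurd hsign this.not_gt
  · by_contra hn
    have := mul_nonneg (sub_nonneg.mpr (not_lt.mp hn)) (sub_nonneg.mpr (hab.le.trans (not_lt.mp hn)))
    refine absurd hsign (not_lt.mpr ?_)
    linarith
  · exact hgr.dvd hgf

end IsFieldCone

/-- Every ordered field has an algebraic ordered extension satisfying the intermediate value
property for polynomials. -/
theorem RingPreordering.IsOrdering.exists_polynomialIVT {F : Type*} [Field F]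
    {P : RingPreordering F} (hP : P.IsOrdering) :
    ∃ (M : Subfield (AlgebraicClosure F)) (_ : LinearOrder M) (_ : IsStrictOrderedRing M)
      (_ : Algebra F M), Algebra.IsAlgebraic F M ∧ PolynomialIVT M ∧
        ∀ x, 0 ≤ algebraMap F M x ↔ x ∈ P := by
  -- A cone determines both its subfield and the order on it, so inclusion of cones is extension of
  -- ordered fields.
  obtain ⟨R, hPR, hR⟩ := zorn_subset_nonempty {S : Set (AlgebraicClosure F) | IsFieldCone S}
    (fun c hc hch hne => ⟨⋃₀ c, IsFieldCone.sUnion hc hch hne, fun s hs =>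
      Set.subset_sUnion_of_mem hs⟩) _ (IsFieldCone.of_isOrdering hP (algebraMap F _))
  replace hR : Maximal IsFieldCone R := hR
  obtain ⟨o, ho, h⟩ := hR.prop.exists_linearOrder
  have hmem : ∀ x : F, algebraMap F (AlgebraicClosure F) x ∈ hR.prop.subfield := fun x =>
    (hP.mem_or_neg_mem' x).imp (fun hx => hPR ⟨x, hx, rfl⟩)
      (fun hx => hPR ⟨-x, hx, map_neg _ x⟩)
  let alg : Algebra F hR.prop.subfield := ((algebraMap F (AlgebraicClosure F)).codRestrict
    hR.prop.subfield hmem).toAlgebra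
  have tower : IsScalarTower F hR.prop.subfield (AlgebraicClosure F) :=
    IsScalarTower.of_algebraMap_eq fun _ => rfl
  refine ⟨hR.prop.subfield, o, ho, alg, Algebra.IsAlgebraic.tower_bot F _ (AlgebraicClosure F),
    IsFieldCone.polynomialIVT_of_maximal hR h, fun x => ?_⟩
  rw [h]
  refine ⟨fun hx => ?_, fun hx => hPR ⟨x, hx, rfl⟩⟩
  rcases hP.mem_or_neg_mem' x with hx' | hx'
  · exact hx'
  · have h0 := hR.prop.eq_zero_of_neg_mem hx (hPR ⟨-x, hx', map_neg _ x⟩)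
    have : x = 0 := (algebraMap F (AlgebraicClosure F)).injective (by rw [map_zero]; exact h0)
    exact this ▸ zero_mem P

/-! ### Zeros, cuts and signs over a common ordered subfield -/

namespace PolynomialIVT

variable {M : Type*} [Field M] [LinearOrder M] [IsStrictOrderedRing M]

/-- Rolle's theorem for polynomials without multiple roots. -/
theorem exists_derivative_eval_eq_zero (hM : PolynomialIVT M) {f : M[X]}
    (hsep : ∀ z, f.eval z = 0 → f.derivative.eval z ≠ 0) {x y : M} (hxy : x < y)
    (hx : f.eval x = 0) (hy : f.eval y = 0) :
    ∃ z, x < z ∧ z < y ∧ f.derivative.eval z = 0 := by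
  have hf0 : f ≠ 0 := by
    rintro rfl
    exact hsep x hx (by simp)
  have hne : (f.roots.toFinset.filter (x < ·)).Nonempty :=
    ⟨y, by simp [hf0, hy, hxy]⟩
  -- With `w` the next root after `x`, `f = (X - x) * (X - w) * g` and `g` keeps its sign on `[x,
  -- w]`; hence the derivative has opposite signs at `x` and `w`.
  set w := (f.roots.toFinset.filter (x < ·)).min' hne with hw
  have hwmem := Finset.min'_mem _ hne
  rw [← hw] at hwmem
  obtain ⟨hfw, hxw⟩ : f.eval w = 0 ∧ x < w := by simpa [hf0] using hwmem
  have hwy : w ≤ y := Finset.min'_le _ _ (by simp [hf0, hy, hxy])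
  have hmin : ∀ z, x < z → f.eval z = 0 → w ≤ z := fun z hz hfz =>
    Finset.min'_le _ _ (by simp [hf0, hfz, hz])
  obtain ⟨g₁, hg₁⟩ := dvd_iff_isRoot.mpr hx
  have hg₁w : g₁.eval w = 0 := by
    rw [hg₁, eval_mul] at hfw
    exact (mul_eq_zero.mp hfw).resolve_left (by simpa [sub_eq_zero] using hxw.ne')
  obtain ⟨g, hg⟩ := dvd_iff_isRoot.mpr hg₁w
  rw [hg] at hg₁
  have hdx : f.derivative.eval x = (x - w) * g.eval x := by
    rw [hg₁]
    simp [derivative_mul]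
  have hdw : f.derivative.eval w = (w - x) * g.eval w := by
    rw [hg₁]
    simp [derivative_mul]
  have hgx : g.eval x ≠ 0 := fun h => hsep x hx (by rw [hdx, h, mul_zero])
  have hgw : g.eval w ≠ 0 := fun h => hsep w hfw (by rw [hdw, h, mul_zero])
  have hpos : 0 < g.eval x * g.eval w := by
    refine lt_of_le_of_ne (not_lt.mp fun hn => ?_) (mul_ne_zero hgx hgw).symm
    obtain ⟨z, hxz, hzw, hz⟩ := hM g x w hxw hn
    refine (hmin z hxz ?_).not_gt hzw
    rw [hg₁]
    simp [hz]
  obtain ⟨z, h1, h2, h3⟩ := hM f.derivative x w hxw (by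
    rw [hdx, hdw]
    have := mul_pos (mul_pos (sub_pos.mpr hxw) (sub_pos.mpr hxw)) hpos
    nlinarith)
  exact ⟨z, h1, h2.trans_le hwy, h3⟩

theorem eval_mul_eval_pos (hM : PolynomialIVT M) {f : M[X]} (hf : ∀ z, f.eval z ≠ 0) (x y : M) :
    0 < f.eval x * f.eval y := by
  rcases lt_trichotomy x y with h | rfl | h
  · refine lt_of_le_of_ne (not_lt.mp fun hn => ?_) (mul_ne_zero (hf x) (hf y)).symm
    obtain ⟨z, -, -, hz⟩ := hM f x y h hn
    exact hf z hz
  · exact mul_self_pos.mpr (hf x)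
  · refine lt_of_le_of_ne (not_lt.mp fun hn => ?_) (mul_ne_zero (hf x) (hf y)).symm
    obtain ⟨z, -, -, hz⟩ := hM f y x h (by rwa [mul_comm])
    exact hf z hz

variable {E : Type*} [Field E] [LinearOrder E] [IsStrictOrderedRing E]

/-- Nonzero polynomials are bounded away from zero outside of a bounded set. -/
theorem exists_bound {i : E →+* M} (hi : StrictMono i) (f : E[X]) (hf : f ≠ 0) :
    ∃ B δ : E, 0 < δ ∧ ∀ z : M, i B ≤ |z| → i δ ≤ |f.eval₂ i z| := by
  induction hn : f.natDegree using Nat.strong_induction_on generalizing f with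
  | _ n ih =>
    by_cases h0 : f.divX = 0
    · have hfC : f = C (f.coeff 0) := by simpa [h0] using (divX_mul_X_add f).symm
      refine ⟨0, |f.coeff 0|, abs_pos.mpr fun h => hf (by rw [hfC, h, C_0]), fun z _ => ?_⟩
      rw [hfC, eval₂_C, coeff_C_zero]
      rcases abs_cases (f.coeff 0) with ⟨h, -⟩ | ⟨h, -⟩
      · rw [h]; exact le_abs_self _
      · rw [h, map_neg]; exact neg_le_abs _
    · have hdeg : f.divX.natDegree < n := by
        have h1 := natDegree_divX_eq_natDegree_tsub_one (p := f)
        have h2 : f.natDegree ≠ 0 := fun h => h0 <|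
          divX_eq_zero_iff.mpr (eq_C_of_natDegree_eq_zero h)
        omega
      obtain ⟨B, δ, hδ, hB⟩ := ih _ hdeg f.divX h0 rfl
      -- The second bound makes `f.divX * X` at least `|f.coeff 0| + 1` in absolute value, which
      -- leaves `1` after the constant term is added.
      refine ⟨max B ((|f.coeff 0| + 1) / δ), 1, one_pos, fun z hz => ?_⟩
      have hz1 : i B ≤ |z| := (hi.monotone (le_max_left _ _)).trans hz
      have hz2 : i ((|f.coeff 0| + 1) / δ) ≤ |z| := (hi.monotone (le_max_right _ _)).trans hz
      have h1 := hB z hz1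
      have hδ' : 0 < i δ := by simpa using hi hδ
      have h2 : i (|f.coeff 0| + 1) ≤ |f.divX.eval₂ i z * z| := by
        rw [abs_mul]
        calc i (|f.coeff 0| + 1) = i δ * i ((|f.coeff 0| + 1) / δ) := by
              rw [← map_mul, mul_div_cancel₀ _ hδ.ne']
          _ ≤ _ := mul_le_mul h1 hz2 (by
              rw [← map_zero i]
              exact hi.monotone (by positivity)) (abs_nonneg _)
      have h3 : |i (f.coeff 0)| ≤ i |f.coeff 0| := by
        rw [abs_le, ← map_neg]
        exact ⟨hi.monotone (neg_abs_le _), hi.monotone (le_abs_self _)⟩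
      have h4 : f.eval₂ i z = f.divX.eval₂ i z * z + i (f.coeff 0) := by
        conv_lhs => rw [← divX_mul_X_add f]
        simp
      rw [h4]
      have h5 := abs_sub_abs_le_abs_sub (f.divX.eval₂ i z * z) (-i (f.coeff 0))
      rw [sub_neg_eq_add, abs_neg] at h5
      rw [map_add, map_one] at h2
      rw [map_one]
      linarith

theorem exists_abs_lt_of_eval₂_eq_zero {i : E →+* M} (hi : StrictMono i) {f : E[X]} (hf : f ≠ 0)
    {x : M} (hx : f.eval₂ i x = 0) : ∃ B : E, |x| < i B := by
  obtain ⟨B, δ, hδ, hB⟩ := exists_bound hi f hf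
  refine ⟨B, not_le.mp fun h => ?_⟩
  have := hB x h
  rw [hx, abs_zero, ← map_zero i] at this
  exact (hi.le_iff_le.mp this).not_gt hδ

/-- All zeros in `M` of nonzero polynomials over `E` of degree less than `n` lie in `E`. -/
def ContainsZeros (i : E →+* M) (n : ℕ) : Prop :=
  ∀ g : E[X], g ≠ 0 → g.natDegree < n → ∀ z : M, g.eval₂ i z = 0 → z ∈ i.range

variable {M' : Type*} [Field M'] [LinearOrder M'] [IsStrictOrderedRing M']
  {i : E →+* M} {i' : E →+* M'} {n : ℕ}

/-- A zero `t` of `g` in `E` splits off a factor `X - t`, whose sign is read from the cut. Without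
zeros in `E`, `g` has none in `M` or `M'` either, so its sign is constantly that of `g.eval 0`. -/
theorem eval₂_pos_iff_of_cut (hM : PolynomialIVT M) (hM' : PolynomialIVT M')
    (hi : StrictMono i) (hi' : StrictMono i') (hn : ContainsZeros i n) (hn' : ContainsZeros i' n)
    {x : M} {x' : M'} (hx : x ∉ i.range) (hx' : x' ∉ i'.range)
    (hcut : ∀ t, i t < x ↔ i' t < x') (g : E[X]) (hg : g.natDegree < n) :
    0 < g.eval₂ i x ↔ 0 < g.eval₂ i' x' := by
  by_cases hg0 : g = 0
  · simp [hg0]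
  induction hd : g.natDegree using Nat.strong_induction_on generalizing g with
  | _ m ih =>
    have key : ∀ {h : E[X]}, h ≠ 0 → h.natDegree < n → h.eval₂ i x ≠ 0 ∧ h.eval₂ i' x' ≠ 0 :=
      fun h0 hlt => ⟨fun h => hx (hn _ h0 hlt _ h), fun h => hx' (hn' _ h0 hlt _ h)⟩
    by_cases hroot : ∃ t, g.eval t = 0
    · obtain ⟨t, ht⟩ := hroot
      obtain ⟨h, rfl⟩ := dvd_iff_isRoot.mpr ht
      have h0 : h ≠ 0 := right_ne_zero_of_mul hg0
      have hdeg : m = 1 + h.natDegree := by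
        rw [← hd, natDegree_mul (X_sub_C_ne_zero t) h0, natDegree_X_sub_C]
      have hh := ih h.natDegree (by omega) h (by omega) h0 rfl
      obtain ⟨k1, k2⟩ := key h0 (by omega : h.natDegree < n)
      have e1 : 0 < h.eval₂ i x ∨ h.eval₂ i x < 0 := (lt_or_gt_of_ne k1).symm
      have e2 : 0 < h.eval₂ i' x' ∨ h.eval₂ i' x' < 0 := (lt_or_gt_of_ne k2).symm
      simp only [eval₂_mul, eval₂_sub, eval₂_X, eval₂_C]
      rw [mul_pos_iff, mul_pos_iff, sub_pos, sub_pos, sub_neg, sub_neg]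
      have hlt : x < i t ↔ x' < i' t := by
        have h1 : x ≠ i t := fun h => hx ⟨t, h.symm⟩
        have h2 : x' ≠ i' t := fun h => hx' ⟨t, h.symm⟩
        rw [← h1.le_iff_lt, ← h2.le_iff_lt, ← not_lt, ← not_lt, hcut]
      have hneg : h.eval₂ i x < 0 ↔ h.eval₂ i' x' < 0 := by
        rw [← k1.le_iff_lt, ← k2.le_iff_lt, ← not_lt, ← not_lt, hh]
      rw [hcut, hlt, hh, hneg]
    · push Not at hroot
      have r1 : ∀ z, (g.map i).eval z ≠ 0 := fun z hz => by
        rw [eval_map] at hz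
        obtain ⟨t, rfl⟩ := hn g hg0 hg z hz
        rw [eval₂_at_apply] at hz
        exact hroot t (i.injective (by rw [hz, map_zero]))
      have r2 : ∀ z, (g.map i').eval z ≠ 0 := fun z hz => by
        rw [eval_map] at hz
        obtain ⟨t, rfl⟩ := hn' g hg0 hg z hz
        rw [eval₂_at_apply] at hz
        exact hroot t (i'.injective (by rw [hz, map_zero]))
      have p1 := eval_mul_eval_pos hM r1 x (i 0)
      have p2 := eval_mul_eval_pos hM' r2 x' (i' 0)
      rw [eval_map, eval_map, eval₂_at_apply] at p1 p2
      have s : 0 < i (g.eval 0) ↔ 0 < i' (g.eval 0) := by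
        rw [← map_zero i, ← map_zero i', hi.lt_iff_lt, hi'.lt_iff_lt]
      constructor
      · intro h
        exact (pos_iff_pos_of_mul_pos p2).mpr (s.mp ((pos_iff_pos_of_mul_pos p1).mp h))
      · intro h
        exact (pos_iff_pos_of_mul_pos p1).mpr (s.mpr ((pos_iff_pos_of_mul_pos p2).mp h))

/-- Two zeros of a polynomial of degree `n` between which its derivative does not vanish in `E`
agree. -/
theorem eq_of_eval₂_eq_zero (hM : PolynomialIVT M) (hi : StrictMono i) (hn : ContainsZeros i n)
    {f : E[X]} (hfn : f.natDegree = n) (hn0 : n ≠ 0) (hf : ∀ t, f.eval t ≠ 0) {a b : E}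
    (hgap : ∀ s, f.derivative.eval s = 0 → a < s → ¬ s < b) {x y : M}
    (hax : i a ≤ x) (hxb : x ≤ i b) (hay : i a ≤ y) (hyb : y ≤ i b)
    (hx : f.eval₂ i x = 0) (hy : f.eval₂ i y = 0) : x = y := by
  have hd0 : f.derivative ≠ 0 := fun h =>
    hn0 (hfn ▸ derivative_eq_zero.mp h)
  have hdn : f.derivative.natDegree < n := hfn ▸ natDegree_derivative_lt (hfn ▸ hn0)
  -- The derivative has degree below `n`, so its zeros lie in `E`. Since `f` has no zero there, its
  -- zeros are simple and Rolle's theorem applies.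
  have hder : ∀ z, (f.map i).derivative.eval z = 0 →
      ∃ t, i t = z ∧ f.derivative.eval t = 0 := fun z hz => by
    rw [derivative_map, eval_map] at hz
    obtain ⟨t, rfl⟩ := hn _ hd0 hdn z hz
    rw [eval₂_at_apply] at hz
    exact ⟨t, rfl, i.injective (by rw [hz, map_zero])⟩
  have hsep : ∀ z, (f.map i).eval z = 0 → (f.map i).derivative.eval z ≠ 0 := fun z hz hz' => by
    obtain ⟨t, rfl, -⟩ := hder z hz'
    rw [eval_map, eval₂_at_apply] at hz
    exact hf t (i.injective (by rw [hz, map_zero]))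
  have main : ∀ {x y : M}, i a ≤ x → y ≤ i b → f.eval₂ i x = 0 → f.eval₂ i y = 0 → ¬ x < y := by
    intro x y hax hyb hx hy hxy
    obtain ⟨z, h1, h2, h3⟩ := hM.exists_derivative_eval_eq_zero hsep hxy
      (by rwa [eval_map]) (by rwa [eval_map])
    obtain ⟨t, rfl, ht⟩ := hder z h3
    exact hgap t ht (hi.lt_iff_lt.mp (hax.trans_lt h1)) (hi.lt_iff_lt.mp (h2.trans_le hyb))
  exact le_antisymm (not_lt.mp (main hay hxb hy hx)) (not_lt.mp (main hax hyb hx hy))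

/-- A zero of minimal degree in `M` is matched by a zero in the same cut of `M'`. -/
theorem exists_eval₂_eq_zero_cut (hM : PolynomialIVT M) (hM' : PolynomialIVT M')
    (hi : StrictMono i) (hi' : StrictMono i') (hn : ContainsZeros i n) (hn' : ContainsZeros i' n)
    {f : E[X]} (hf0 : f ≠ 0) (hfn : f.natDegree = n) {x : M} (hx : x ∉ i.range)
    (hfx : f.eval₂ i x = 0) :
    ∃ x' : M', x' ∉ i'.range ∧ f.eval₂ i' x' = 0 ∧ ∀ t, i t < x ↔ i' t < x' := by
  have hxne : ∀ t, i t ≠ x := fun t h => hx ⟨t, h⟩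
  have hf : ∀ t, f.eval t ≠ 0 := fun t ht => by
    obtain ⟨h, rfl⟩ := dvd_iff_isRoot.mpr ht
    have h0 : h ≠ 0 := right_ne_zero_of_mul hf0
    rw [natDegree_mul (X_sub_C_ne_zero t) h0, natDegree_X_sub_C] at hfn
    simp only [eval₂_mul, eval₂_sub, eval₂_X, eval₂_C, mul_eq_zero, sub_eq_zero] at hfx
    exact hfx.elim (fun h => hxne t h.symm) fun hh => hx (hn h h0 (by omega) x hh)
  have hn0 : n ≠ 0 := by
    rintro rfl
    rw [eq_C_of_natDegree_eq_zero hfn, eval₂_C, map_eq_zero] at hfx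
    exact hf0 (by rw [eq_C_of_natDegree_eq_zero hfn, hfx, C_0])
  have hd0 : f.derivative ≠ 0 := fun h =>
    hn0 (hfn ▸ derivative_eq_zero.mp h)
  obtain ⟨B, hB⟩ := exists_abs_lt_of_eval₂_eq_zero hi hf0 hfx
  rw [abs_lt, ← map_neg] at hB
  -- `a` and `b` are the neighbours of `x` among `B`, `-B` and the zeros of the derivative in `E`.
  obtain ⟨a, b, hax, hxb, hgap⟩ : ∃ a b, i a < x ∧ x < i b ∧
      ∀ s, f.derivative.eval s = 0 → a < s → ¬ s < b := by
    classical
    let T : Finset E := f.derivative.roots.toFinset ∪ {B, -B}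
    have hl : (T.filter (i · < x)).Nonempty := ⟨-B, by simpa [T] using hB.1⟩
    have hr : (T.filter (x < i ·)).Nonempty := ⟨B, by simp [T, hB.2]⟩
    refine ⟨(T.filter (i · < x)).max' hl, (T.filter (x < i ·)).min' hr,
      (Finset.mem_filter.mp (Finset.max'_mem _ hl)).2,
      (Finset.mem_filter.mp (Finset.min'_mem _ hr)).2, fun s hs h1 h2 => ?_⟩
    have hsT : s ∈ T := by simp [T, hd0, hs]
    rcases lt_or_gt_of_ne (hxne s) with h | h
    · exact (Finset.le_max' _ s (by simp [hsT, h])).not_gt h1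
    · exact (Finset.min'_le _ s (by simp [hsT, h])).not_gt h2
  -- `f` changes sign at its simple zero `x`
  have hsign : ∀ s t, a ≤ s → t ≤ b → i s < x → x < i t → f.eval s * f.eval t < 0 := by
    intro s t has htb hsx hxt
    obtain ⟨g, hg⟩ := dvd_iff_isRoot.mpr (show (f.map i).IsRoot x by rwa [IsRoot, eval_map])
    have hfg : ∀ z, f.eval₂ i z = (z - x) * g.eval z := fun z => by
      rw [← eval_map, hg]; simp
    have hd : (f.map i).derivative.eval x = g.eval x := by
      rw [hg]; simp [derivative_mul]
    have hgz : ∀ z, i a ≤ z → z ≤ i b → g.eval z ≠ 0 := by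
      intro z haz hzb hz
      have hzx : z = x := eq_of_eval₂_eq_zero hM hi hn hfn hn0 hf hgap haz hzb hax.le hxb.le
        (by rw [hfg, hz, mul_zero]) hfx
      rw [hzx, ← hd, derivative_map, eval_map] at hz
      exact hx (hn _ hd0 (hfn ▸ natDegree_derivative_lt (hfn ▸ hn0)) x hz)
    have hst : i s < i t := hsx.trans hxt
    have has' := hi.monotone has
    have htb' := hi.monotone htb
    have hpos : 0 < g.eval (i s) * g.eval (i t) := by
      refine lt_of_le_of_ne (not_lt.mp fun hneg => ?_)
        (mul_ne_zero (hgz _ has' (hst.le.trans htb')) (hgz _ (has'.trans hst.le) htb')).symm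
      obtain ⟨z, h1, h2, h3⟩ := hM g _ _ hst hneg
      exact hgz z (has'.trans h1.le) (h2.le.trans htb') h3
    have h1 : f.eval₂ i (i s) * f.eval₂ i (i t) < 0 := by
      rw [hfg, hfg]
      have := mul_pos (mul_pos (sub_pos.mpr hsx) (sub_pos.mpr hxt)) hpos
      nlinarith
    rw [eval₂_at_apply, eval₂_at_apply, ← map_mul, ← map_zero i] at h1
    exact hi.lt_iff_lt.mp h1
  have hzero : ∀ s t, a ≤ s → t ≤ b → i s < x → x < i t →
      ∃ z, i' s < z ∧ z < i' t ∧ f.eval₂ i' z = 0 := by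
    intro s t has htb hsx hxt
    obtain ⟨z, h1, h2, h3⟩ := hM' (f.map i') (i' s) (i' t)
      (hi' (hi.lt_iff_lt.mp (hsx.trans hxt))) (by
        rw [eval_map, eval_map, eval₂_at_apply, eval₂_at_apply, ← map_mul, ← map_zero i']
        exact hi' (hsign s t has htb hsx hxt))
    exact ⟨z, h1, h2, by rwa [eval_map] at h3⟩
  obtain ⟨x', hax', hxb', hfx'⟩ := hzero a b le_rfl le_rfl hax hxb
  have huniq : ∀ z, i' a ≤ z → z ≤ i' b → f.eval₂ i' z = 0 → z = x' := fun z h1 h2 h3 =>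
    eq_of_eval₂_eq_zero hM' hi' hn' hfn hn0 hf hgap h1 h2 hax'.le hxb'.le h3 hfx'
  -- For `t` between `a` and `b`, `f` changes sign on the side of `t` that contains `x`. This yields
  -- a zero in `M'` on that side, which is `x'` by uniqueness.
  refine ⟨x', ?_, hfx', fun t => ⟨fun ht => ?_, fun ht => ?_⟩⟩
  · rintro ⟨t, rfl⟩
    rw [eval₂_at_apply] at hfx'
    exact hf t (i'.injective (by rw [hfx', map_zero]))
  · rcases le_total t a with hta | hat
    · exact (hi'.monotone hta).trans_lt hax'
    · obtain ⟨z, h1, h2, h3⟩ := hzero t b hat le_rfl ht hxb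
      rwa [← huniq z ((hi'.monotone hat).trans h1.le) h2.le h3]
  · by_contra hxt
    replace hxt : x < i t := lt_of_le_of_ne (not_lt.mp hxt) (hxne t).symm
    rcases le_total b t with hbt | htb
    · exact absurd (hxb'.trans_le (hi'.monotone hbt)) ht.not_gt
    · obtain ⟨z, h1, h2, h3⟩ := hzero a t le_rfl htb hax hxt
      rw [huniq z h1.le (h2.le.trans (hi'.monotone htb)) h3] at h2
      exact absurd h2 ht.not_gt

/-- Modulo `f`, which vanishes at both points, every polynomial reduces to degree below `n`, where
the cut decides the sign. -/
theorem exists_eval₂_nonneg_iff (hM : PolynomialIVT M) (hM' : PolynomialIVT M')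
    (hi : StrictMono i) (hi' : StrictMono i') (hn : ContainsZeros i n) (hn' : ContainsZeros i' n)
    {f : E[X]} (hf0 : f ≠ 0) (hfn : f.natDegree = n) {x : M} (hx : x ∉ i.range)
    (hfx : f.eval₂ i x = 0) :
    ∃ x' : M', x' ∉ i'.range ∧ ∀ p : E[X], 0 ≤ p.eval₂ i x ↔ 0 ≤ p.eval₂ i' x' := by
  obtain ⟨x', hx', hfx', hcut⟩ := exists_eval₂_eq_zero_cut hM hM' hi hi' hn hn' hf0 hfn hx hfx
  have hn0 : n ≠ 0 := by
    rintro rfl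
    rw [eq_C_of_natDegree_eq_zero hfn, eval₂_C, map_eq_zero] at hfx
    exact hf0 (by rw [eq_C_of_natDegree_eq_zero hfn, hfx, C_0])
  have hpos : ∀ p : E[X], 0 < p.eval₂ i x ↔ 0 < p.eval₂ i' x' := fun p => by
    have h := eval₂_pos_iff_of_cut hM hM' hi hi' hn hn' hx hx' hcut (p % f)
      (hfn ▸ natDegree_mod_lt p (hfn ▸ hn0))
    rwa [show p.eval₂ i x = (p % f).eval₂ i x by
        conv_lhs => rw [← EuclideanDomain.div_add_mod p f]
        rw [eval₂_add, eval₂_mul, hfx, zero_mul, zero_add],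
      show p.eval₂ i' x' = (p % f).eval₂ i' x' by
        conv_lhs => rw [← EuclideanDomain.div_add_mod p f]
        rw [eval₂_add, eval₂_mul, hfx', zero_mul, zero_add]]
  refine ⟨x', hx', fun p => ?_⟩
  have := hpos (-p)
  rw [eval₂_neg, eval₂_neg, neg_pos, neg_pos] at this
  rw [← not_lt, ← not_lt, this]

end PolynomialIVT

/-! ### Uniqueness of real closures -/

namespace PolynomialIVT

variable {k M M' : Type*} [Field k] [Field M] [LinearOrder M] [IsStrictOrderedRing M] [Field M']
  [LinearOrder M'] [IsStrictOrderedRing M'] [Algebra k M] [Algebra k M']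

/-- A subalgebra of `M' × M` whose elements have components of the same sign. -/
def SameSign (S : Subalgebra k (M' × M)) : Prop := ∀ s ∈ S, 0 ≤ s.1 ↔ 0 ≤ s.2

-- Such subalgebras are the graphs of partial order embeddings of `M'` into `M` over `k`; a maximal
-- one will turn out to be defined on all of `M'`.
omit [IsStrictOrderedRing M] [IsStrictOrderedRing M'] in
theorem exists_maximal_sameSign
    (hk : ∀ x : k, 0 ≤ algebraMap k M' x ↔ 0 ≤ algebraMap k M x) :
    ∃ S : Subalgebra k (M' × M), Maximal SameSign S := by
  obtain ⟨S, -, hS⟩ := zorn_le_nonempty₀ {S : Subalgebra k (M' × M) | SameSign S}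
    (fun c hc hch T hT => by
      refine ⟨sSup c, fun s hs => ?_, fun U hU => le_sSup hU⟩
      have : Nonempty c := ⟨⟨T, hT⟩⟩
      rw [sSup_eq_iSup', ← SetLike.mem_coe,
        Subalgebra.coe_iSup_of_directed hch.directedOn.directed_val, Set.mem_iUnion] at hs
      obtain ⟨U, hU⟩ := hs
      exact hc U.2 s hU) ⊥ (by
      intro s hs
      obtain ⟨x, rfl⟩ := Algebra.mem_bot.mp hs
      exact hk x)
  exact ⟨S, hS⟩

theorem SameSign.eq_zero_iff {S : Subalgebra k (M' × M)} (hS : SameSign S) {s : M' × M}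
    (hs : s ∈ S) : s.1 = 0 ↔ s.2 = 0 := by
  have h1 := hS s hs
  have h2 := hS (-s) (neg_mem hs)
  simp only [Prod.fst_neg, Prod.snd_neg, neg_nonneg] at h2
  rw [le_antisymm_iff, le_antisymm_iff, h1, h2]

-- The hypothesis says that adjoining `z` to `S` keeps the signs equal, so maximality applies.
omit [IsStrictOrderedRing M] [IsStrictOrderedRing M'] in
theorem mem_of_maximal_sameSign {S : Subalgebra k (M' × M)} (hS : Maximal SameSign S)
    {z : M' × M} (hz : ∀ p : S[X], 0 ≤ (aeval z p).1 ↔ 0 ≤ (aeval z p).2) : z ∈ S := by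
  let T : Subalgebra k (M' × M) := ((aeval z : S[X] →ₐ[S] M' × M).restrictScalars k).range
  have hle : S ≤ T := fun s hs => ⟨C ⟨s, hs⟩, aeval_C z (⟨s, hs⟩ : S)⟩
  have hT : SameSign T := by
    rintro _ ⟨p, rfl⟩
    exact hz p
  exact hS.le_of_ge hT hle ⟨X, aeval_X z⟩

/-- Uniqueness of real closures: `M'` embeds into `M` as an ordered field. -/
theorem exists_algHom [Algebra.IsAlgebraic k M'] (hM : PolynomialIVT M) (hM' : PolynomialIVT M')
    (hk : ∀ x : k, 0 ≤ algebraMap k M' x ↔ 0 ≤ algebraMap k M x) :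
    ∃ ψ : M' →ₐ[k] M, ∀ a, 0 ≤ ψ a ↔ 0 ≤ a := by
  classical
  obtain ⟨S, hS⟩ := exists_maximal_sameSign hk
  let π : S →ₐ[k] M' := (AlgHom.fst k M' M).comp S.val
  have hπ : Function.Injective π := by
    rw [injective_iff_map_eq_zero]
    intro s hs
    exact Subtype.ext (Prod.ext hs ((hS.prop.eq_zero_iff s.2).mp hs))
  let E : IntermediateField k M' := π.range.toIntermediateField fun x hx =>
    π.range.inv_mem_of_algebraic (x := ⟨x, hx⟩) (Algebra.IsAlgebraic.isAlgebraic _)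
  let e : S ≃ₐ[k] E := AlgEquiv.ofInjective π hπ
  have he : ∀ s : S, ((e s : E) : M') = (s : M' × M).1 := fun s => rfl
  let i' : E →+* M' := E.val.toRingHom
  let i : E →+* M := (((AlgHom.snd k M' M).comp S.val).comp e.symm.toAlgHom).toRingHom
  have hie : ∀ s : S, i (e s) = (s : M' × M).2 := fun s => by
    change ((e.symm (e s) : S) : M' × M).2 = _
    rw [AlgEquiv.symm_apply_apply]
  have hi' : StrictMono i' := fun _ _ h => h
  have hi : StrictMono i := by
    refine (monotone_iff_map_nonneg i).mpr (fun a ha => ?_) |>.strictMono_of_injective i.injective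
    obtain ⟨s, rfl⟩ := e.surjective a
    rw [hie]
    exact (hS.prop s s.2).mp ha
  have hmem : ∀ (x : M) (x' : M'), x' ∉ i'.range →
      ¬ ∀ p : E[X], 0 ≤ p.eval₂ i x ↔ 0 ≤ p.eval₂ i' x' := by
    intro x x' hx' h
    have hxS : (x', x) ∈ S := mem_of_maximal_sameSign hS fun p => by
      have h1 : (aeval (x', x) p).1 = (p.map (e : S →+* E)).eval₂ i' x' := by
        rw [eval₂_map, aeval_def]
        exact hom_eval₂ p (algebraMap S (M' × M)) (RingHom.fst M' M) (x', x)
      have h2 : (aeval (x', x) p).2 = (p.map (e : S →+* E)).eval₂ i x := by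
        rw [eval₂_map, aeval_def]
        refine (hom_eval₂ p (algebraMap S (M' × M)) (RingHom.snd M' M) (x', x)).trans ?_
        congr 1
        ext s
        exact (hie s).symm
      rw [h1, h2, h]
    exact hx' ⟨e ⟨_, hxS⟩, rfl⟩
  have htop : ∀ x' : M', x' ∈ i'.range := by
    by_contra! hne
    obtain ⟨y, hy⟩ := hne
    -- The degree is minimised over new zeros in `M` and `M'` together, so that `ContainsZeros`
    -- holds on both sides. A zero on either side then has a partner on the other, and the pair
    -- enlarges `S`.
    have hex : ∃ n, ∃ f : E[X], f ≠ 0 ∧ f.natDegree = n ∧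
        ((∃ x ∉ i.range, f.eval₂ i x = 0) ∨ ∃ x ∉ i'.range, f.eval₂ i' x = 0) := by
      obtain ⟨p, hp, hpy⟩ := Algebra.IsAlgebraic.isAlgebraic (R := E) y
      exact ⟨_, p, hp, rfl, .inr ⟨y, hy, hpy⟩⟩
    obtain ⟨f, hf0, hfn, hf⟩ := Nat.find_spec hex
    have hmin := fun {m} => Nat.find_min hex (m := m)
    have hn : ContainsZeros i (Nat.find hex) := fun g hg0 hg z hz => by
      by_contra hzE
      exact hmin hg ⟨g, hg0, rfl, .inl ⟨z, hzE, hz⟩⟩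
    have hn' : ContainsZeros i' (Nat.find hex) := fun g hg0 hg z hz => by
      by_contra hzE
      exact hmin hg ⟨g, hg0, rfl, .inr ⟨z, hzE, hz⟩⟩
    rcases hf with ⟨x, hx, hfx⟩ | ⟨x', hx', hfx'⟩
    · obtain ⟨x', hx', h⟩ := exists_eval₂_nonneg_iff hM hM' hi hi' hn hn' hf0 hfn hx hfx
      exact hmem x x' hx' h
    · obtain ⟨x, -, h⟩ := exists_eval₂_nonneg_iff hM' hM hi' hi hn' hn hf0 hfn hx' hfx'
      exact hmem x x' hx' fun p => (h p).symm
  have hE : ∀ x' : M', x' ∈ E := fun x' => by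
    obtain ⟨a, rfl⟩ := htop x'
    exact a.2
  have hπs : Function.Surjective π := fun x' => hE x'
  refine ⟨((AlgHom.snd k M' M).comp S.val).comp
    (AlgEquiv.ofBijective π ⟨hπ, hπs⟩).symm.toAlgHom, fun a => ?_⟩
  obtain ⟨s, rfl⟩ := hπs a
  have : (AlgEquiv.ofBijective π ⟨hπ, hπs⟩).symm (π s) = s :=
    (AlgEquiv.ofBijective π ⟨hπ, hπs⟩).symm_apply_apply s
  simp only [AlgHom.comp_apply, AlgEquiv.toAlgHom_apply, this]
  exact (hS.prop s s.2).symm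

end PolynomialIVT

end Polynomial

/-! ### Orderings, embeddings and the trace form -/

section Trace

variable {k K : Type*} [Field k] [Field K] [Algebra k K]

/-- An ordering of `K` extending `P` is induced by an embedding of `K` into a given real closure
of `(k, P)`. -/
theorem exists_algHom_of_mem_orderingExtensions [FiniteDimensional k K] {P : RingPreordering k}
    {M : Type*} [Field M] [LinearOrder M] [IsStrictOrderedRing M] [Algebra k M]
    (hM : PolynomialIVT M) (hk : ∀ x, 0 ≤ algebraMap k M x ↔ x ∈ P) {Q : RingPreordering K}
    (hQ : Q ∈ orderingExtensions K P) : ∃ σ : K →ₐ[k] M, ∀ x, 0 ≤ σ x ↔ x ∈ Q := by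
  obtain ⟨M', _, _, _, halg, hM', hQM'⟩ := hQ.1.exists_polynomialIVT
  let _ : Algebra k M' := ((algebraMap K M').comp (algebraMap k K)).toAlgebra
  have : IsScalarTower k K M' := IsScalarTower.of_algebraMap_eq fun _ => rfl
  have : Algebra.IsAlgebraic k M' := Algebra.IsAlgebraic.trans k K M'
  obtain ⟨ψ, hψ⟩ := PolynomialIVT.exists_algHom (k := k) hM hM' fun x => by
    rw [hk, ← hQ.2 x, ← hQM', ← IsScalarTower.algebraMap_apply]
  refine ⟨ψ.comp (IsScalarTower.toAlgHom k K M'), fun x => ?_⟩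
  rw [AlgHom.comp_apply, hψ, IsScalarTower.coe_toAlgHom', hQM']

/-- If an ordering `P` of `k` has `[K : k]` extensions to `K`, then the trace form of `K` over `k`
is positive semidefinite with respect to `P`. -/
theorem trace_sq_mem_of_encard_orderingExtensions [FiniteDimensional k K] [CharZero k]
    {P : RingPreordering k} (hP : P.IsOrdering)
    (h : (orderingExtensions K P).encard = Module.finrank k K) (x : K) :
    Algebra.trace k K (x ^ 2) ∈ P := by
  obtain ⟨M, _, _, _, -, hM, hk⟩ := hP.exists_polynomialIVT
  have : Nonempty (K →ₐ[k] M) := by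
    obtain ⟨Q, hQ⟩ : (orderingExtensions K P).Nonempty := by
      rw [← Set.encard_ne_zero, h]
      exact_mod_cast Module.finrank_pos.ne'
    exact ⟨(exists_algHom_of_mem_orderingExtensions hM hk hQ).choose⟩
  choose! σ hσ using fun Q hQ => exists_algHom_of_mem_orderingExtensions (K := K) (Q := Q) hM hk hQ
  have hinj : Set.InjOn σ (orderingExtensions K P) := by
    intro Q hQ Q' hQ' heq
    refine SetLike.ext fun x => ?_
    rw [← hσ Q hQ, heq, hσ Q' hQ']
  let Ω := AlgebraicClosure M
  let c : (K →ₐ[k] M) → (K →ₐ[k] Ω) := (IsScalarTower.toAlgHom k M Ω).comp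
  have hc : Function.Injective c := fun σ τ hστ => AlgHom.ext fun x =>
    (algebraMap M Ω).injective (DFunLike.congr_fun hστ x)
  -- There are at least `[K : k]` embeddings into `M`, one per ordering, and exactly `[K : k]` into
  -- `Ω`. Hence all embeddings into `Ω` land in `M`.
  have hcard : Fintype.card (K →ₐ[k] M) = Fintype.card (K →ₐ[k] Ω) := by
    refine le_antisymm (Fintype.card_le_of_injective c hc) ?_
    rw [AlgHom.card k K Ω]
    have h1 := Set.encard_le_encard (Set.subset_univ (σ '' orderingExtensions K P))
    rw [hinj.encard_image, h, Set.encard_univ, ENat.card_eq_coe_fintype_card] at h1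
    exact_mod_cast h1
  have hbij : Function.Bijective c := (Fintype.bijective_iff_injective_and_card c).mpr ⟨hc, hcard⟩
  have htr : algebraMap k M (Algebra.trace k K (x ^ 2)) = ∑ τ : K →ₐ[k] M, τ x ^ 2 := by
    refine (algebraMap M Ω).injective ?_
    rw [← IsScalarTower.algebraMap_apply, trace_eq_sum_embeddings Ω, map_sum]
    refine (hbij.sum_comp (fun τ => τ (x ^ 2))).symm.trans (Finset.sum_congr rfl fun τ _ => ?_)
    rw [← map_pow]
    rfl
  rw [← hk, htr]
  exact Finset.sum_nonneg fun τ _ => sq_nonneg _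

end Trace

/-! ### Diagonalisation and transfer along a linear form -/

section Orthogonal

variable {k K : Type*} [Field k] [Field K] [Algebra k K]

/-- A linear form `s` on `K` with `s 1 = 1` admits a spanning family of `[K : k]` elements which
starts with `1` and is orthogonal for the form `s (x * y)`. -/
theorem exists_orthogonal_span_eq_top [FiniteDimensional k K] (h2 : (2 : k) ≠ 0)
    (s : K →ₗ[k] k) (hs : s 1 = 1) {d : ℕ} (hd : Module.finrank k K = d) (h0 : 0 < d) :
    ∃ e : Fin d → K, e ⟨0, h0⟩ = 1 ∧ Submodule.span k (Set.range e) = ⊤ ∧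
      ∀ i j, i ≠ j → s (e i * e j) = 0 := by
  have hrank : Module.finrank k (LinearMap.ker s) + 1 = d := by
    have hsurj : LinearMap.range s = ⊤ := LinearMap.range_eq_top.mpr fun a =>
      ⟨a • 1, by rw [map_smul, hs, smul_eq_mul, mul_one]⟩
    have := s.finrank_range_add_finrank_ker
    rw [hsurj, finrank_top, Module.finrank_self] at this
    omega
  subst hrank
  -- The kernel of `s` is the orthogonal complement of `1`, so `1` can be prepended to any
  -- orthogonal basis of it.
  let B : LinearMap.BilinForm k (LinearMap.ker s) :=
    ((LinearMap.mul k K).compr₂ s).domRestrict₁₂ _ _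
  have hB : ∀ x y, B x y = s (x * y) := fun _ _ => rfl
  have : Invertible (2 : k) := invertibleOfNonzero h2
  obtain ⟨v, hv⟩ := LinearMap.BilinForm.exists_orthogonal_basis (B := B)
    ⟨fun x y => by rw [hB, hB, mul_comm]; rfl⟩
  refine ⟨Fin.cons 1 fun j => (v j : K), rfl, ?_, ?_⟩
  · rw [eq_top_iff]
    intro x _
    have hx : x - s x • 1 ∈ LinearMap.ker s := by
      rw [LinearMap.mem_ker, map_sub, map_smul, hs, smul_eq_mul, mul_one, sub_self]
    rw [← sub_add_cancel x (s x • 1)]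
    refine add_mem ?_ (Submodule.smul_mem _ _ (Submodule.subset_span ⟨0, rfl⟩))
    have h1 := congrArg (LinearMap.ker s).subtype (v.sum_repr ⟨_, hx⟩)
    rw [map_sum] at h1
    simp only [map_smul, Submodule.subtype_apply] at h1
    rw [← h1]
    exact Submodule.sum_mem _ fun j _ =>
      Submodule.smul_mem _ _ (Submodule.subset_span ⟨j.succ, rfl⟩)
  · intro i j hij
    induction i using Fin.cases with
    | zero =>
      induction j using Fin.cases with
      | zero => exact absurd rfl hij
      | succ j => simp
    | succ i =>
      induction j using Fin.cases with
      | zero => simp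
      | succ j => exact hv fun h => hij (congrArg Fin.succ h)

/-- Every element of `A ⊗ K` is a combination of a spanning family of `K`. -/
theorem exists_eq_sum_tmul_of_span_eq_top {A : Type*} [CommRing A] [Algebra k A] {ι : Type*}
    [Fintype ι] {e : ι → K} (he : Submodule.span k (Set.range e) = ⊤) (z : A ⊗[k] K) :
    ∃ a : ι → A, z = ∑ i, a i ⊗ₜ[k] e i := by
  induction z with
  | zero => exact ⟨0, by simp⟩
  | add x y hx hy =>
    obtain ⟨a, rfl⟩ := hx
    obtain ⟨b, rfl⟩ := hy
    exact ⟨a + b, by simp [TensorProduct.add_tmul, Finset.sum_add_distrib]⟩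
  | tmul x y =>
    obtain ⟨c, rfl⟩ := (Submodule.mem_span_range_iff_exists_fun k).mp
      (he ▸ Submodule.mem_top : y ∈ Submodule.span k (Set.range e))
    exact ⟨fun i => c i • x, by simp [TensorProduct.tmul_sum, TensorProduct.smul_tmul]⟩

/-- Transfer of sums of squares along a linear form which is diagonal in the family `e`. -/
theorem exists_eq_sum_smul_of_isSumOfNSquares {A : Type*} [CommRing A] [Algebra k A] {ι : Type*}
    [Fintype ι] {s : K →ₗ[k] k} (hs : s 1 = 1) {e : ι → K}
    (he : Submodule.span k (Set.range e) = ⊤) (hort : ∀ i j, i ≠ j → s (e i * e j) = 0)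
    {m : ℕ} {f : A} (hf : IsSumOfNSquares m (f ⊗ₜ[k] (1 : K))) :
    ∃ g : ι → A, (∀ i, IsSumOfNSquares m (g i)) ∧ f = ∑ i, s (e i * e i) • g i := by
  classical
  obtain ⟨z, hz⟩ := hf
  choose a ha using fun j => exists_eq_sum_tmul_of_span_eq_top he (z j)
  refine ⟨fun i => ∑ j, a j i ^ 2, fun i => ⟨fun j => a j i, rfl⟩, ?_⟩
  -- `S` is `id ⊗ s`; it sends `f ⊗ 1` to `f` because `s 1 = 1`.
  let S : A ⊗[k] K →ₗ[k] A := (TensorProduct.rid k A).toLinearMap ∘ₗ LinearMap.lTensor A s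
  have hS : ∀ x y, S (x ⊗ₜ y) = s y • x := fun x y => by simp [S]
  have hsq : ∀ j, S (z j ^ 2) = ∑ i, s (e i * e i) • a j i ^ 2 := by
    intro j
    rw [ha, sq, Finset.sum_mul_sum, map_sum]
    refine Finset.sum_congr rfl fun i _ => ?_
    rw [map_sum, Finset.sum_eq_single i]
    · rw [Algebra.TensorProduct.tmul_mul_tmul, hS, sq]
    · intro l _ hl
      rw [Algebra.TensorProduct.tmul_mul_tmul, hS, hort i l hl.symm, zero_smul]
    · simp
  have h1 := congrArg S hz
  rw [hS, hs, one_smul, map_sum] at h1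
  rw [h1]
  simp_rw [hsq, Finset.smul_sum]
  exact Finset.sum_comm

end Orthogonal

/-! ### Counting squares -/

section SumsOfSquares

variable {R : Type*} [CommRing R]

theorem isSumOfNSquares_iff_exists_fintype {n : ℕ} {x : R} {ι : Type*} [Fintype ι]
    (hι : Fintype.card ι = n) : IsSumOfNSquares n x ↔ ∃ g : ι → R, x = ∑ j, g j ^ 2 := by
  let e := Fintype.equivFinOfCardEq hι
  constructor
  · rintro ⟨g, rfl⟩
    exact ⟨g ∘ e, (e.sum_comp fun j => g j ^ 2).symm⟩
  · rintro ⟨g, rfl⟩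
    exact ⟨g ∘ e.symm, (e.symm.sum_comp fun j => g j ^ 2).symm⟩

theorem IsSumOfNSquares.isSumSq {n : ℕ} {x : R} (hx : IsSumOfNSquares n x) : IsSumSq x := by
  obtain ⟨g, rfl⟩ := hx
  exact IsSumSq.sum fun j _ => by rw [sq]; exact IsSumSq.mul_self _

theorem IsSumSq.map_ringHom {S : Type*} [CommRing S] {x : R} (hx : IsSumSq x) (φ : R →+* S) :
    IsSumSq (φ x) := by
  induction hx with
  | zero => rw [map_zero]; exact .zero
  | sq_add a _ ih => rw [map_add, map_mul]; exact .sq_add _ ih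

theorem IsSumOfNSquares.sum_smul {k A : Type*} [CommRing k] [CommRing A] [Algebra k A] {d m p : ℕ}
    {c : Fin d → k} {g : Fin d → A} (hc : ∀ i, IsSumOfNSquares p (c i))
    (hg : ∀ i, IsSumOfNSquares m (g i)) : IsSumOfNSquares (d * m * p) (∑ i, c i • g i) := by
  choose a ha using hc
  choose b hb using hg
  refine (isSumOfNSquares_iff_exists_fintype (ι := Fin d × Fin m × Fin p)
    (by simp [mul_assoc])).mpr ⟨fun x => a x.1 x.2.2 • b x.1 x.2.1, ?_⟩
  rw [Fintype.sum_prod_type]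
  refine Finset.sum_congr rfl fun i _ => ?_
  rw [Fintype.sum_prod_type, ha i, hb i, Finset.smul_sum]
  refine Finset.sum_congr rfl fun j _ => ?_
  rw [Finset.sum_smul]
  exact Finset.sum_congr rfl fun l _ => (smul_pow _ _ _).symm

theorem isSumOfNSquares_of_pythagorasNumber_eq {p : ℕ} (hp : pythagorasNumber R = p) {x : R}
    (hx : IsSumSq x) : IsSumOfNSquares p x := by
  -- A finite infimum rules out the empty set, whose infimum is `⊤`, and is then attained.
  have hne : {p : ℕ∞ | ∃ n : ℕ, p = n ∧ ∀ x : R, IsSumSq x → IsSumOfNSquares n x}.Nonempty := by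
    by_contra h
    rw [Set.not_nonempty_iff_eq_empty] at h
    rw [pythagorasNumber, h, sInf_empty] at hp
    exact ENat.top_ne_natCast p hp
  obtain ⟨n, hn, h⟩ := csInf_mem hne
  obtain rfl : p = n := by exact_mod_cast hp.symm.trans hn
  exact h x hx

end SumsOfSquares

/-! ### The main theorem -/

theorem theorem1p2 {k K : Type*} [Field k] [Field K] [Algebra k K]
    [IsSemireal k] [IsSemireal K] [FiniteDimensional k K]
    (hext : ∀ P : RingPreordering k, P.IsOrdering →
      (orderingExtensions K P).encard = Module.finrank k K) :
    ∃ c : Fin (Module.finrank k K) → k,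
      (∀ i, IsSumSq (c i)) ∧
      c ⟨0, Module.finrank_pos⟩ = 1 ∧
      ∀ (A : Type*) [CommRing A] [Algebra k A] (m : ℕ), 1 ≤ m →
        ∀ f : A, IsSumOfNSquares m (f ⊗ₜ[k] (1 : K)) →
          (∃ g : Fin (Module.finrank k K) → A,
            (∀ i, IsSumOfNSquares m (g i)) ∧ f = ∑ i, c i • g i) ∧
          IsSumSq f ∧
          ∀ p : ℕ, pythagorasNumber k = p →
            IsSumOfNSquares (Module.finrank k K * m * p) f := by
  have hd : (Module.finrank k K : k) ≠ 0 := Nat.cast_ne_zero.mpr Module.finrank_pos.ne'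
  -- Dividing the trace by the degree gives `s 1 = 1`, hence first weight `1`; the factor is
  -- positive in every ordering.
  let s : K →ₗ[k] k := (Module.finrank k K : k)⁻¹ • Algebra.trace k K
  have hs : s 1 = 1 := by
    have := Algebra.trace_algebraMap (R := k) (S := K) 1
    rw [map_one, nsmul_one] at this
    rw [LinearMap.smul_apply, this, smul_eq_mul, inv_mul_cancel₀ hd]
  obtain ⟨e, he0, he, hort⟩ := exists_orthogonal_span_eq_top two_ne_zero s hs rfl
    Module.finrank_pos
  have hc : ∀ i, IsSumSq (s (e i * e i)) := fun i =>
    RingPreordering.isSumSq_of_forall_mem fun P hP => by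
      rw [← sq]
      exact mul_mem (RingPreordering.inv_mem (natCast_mem P _))
        (trace_sq_mem_of_encard_orderingExtensions hP (hext P hP) (e i))
  refine ⟨fun i => s (e i * e i), hc, by beta_reduce; rw [he0, mul_one, hs], fun A _ _ m _ f hf => ?_⟩
  obtain ⟨g, hg, hfg⟩ := exists_eq_sum_smul_of_isSumOfNSquares hs he hort hf
  refine ⟨⟨g, hg, hfg⟩, ?_, fun p hp => ?_⟩
  · rw [hfg]
    refine IsSumSq.sum fun i _ => ?_
    rw [Algebra.smul_def]
    exact ((hc i).map_ringHom (algebraMap k A)).mul (hg i).isSumSq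
  · rw [hfg]
    exact IsSumOfNSquares.sum_smul
      (fun i => isSumOfNSquares_of_pythagorasNumber_eq hp (hc i)) hg
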